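/- **Setting.** Let $\ell\ge 1$, $L=2^\ell$, $f\ge 0$ (bits of fixed-point precision), $m\ge 1$ (batch size) and $\varepsilon\in\mathbb Q$ (a constant). Three parties $P_1,P_2,P_3$ use replicated secret sharing over $\mathbb Z_L$: $x\equiv x_1+x_2+x_3$, and $P_i$ holds $(x_i,x_{i+1})$ (indices mod $3$). For $x,y\in\mathbb Z_L$ and $d\ge 0$ let $x\cdot_d y=\lfloor \overline{xy}/2^d\rfloor \bmod L$, where $\overline{xy}$ is the product in $\mathbb Z_L$ read as a two's complement integer. A rational constant $q$ with $d$ bits of precision is encoded as $[q]_d=\lfloor q2^d\rfloor \bmod L$. The bounding power of $b\in\mathbb Z_L$, read as an integer in $[0,L)$, is the $\alpha$ with $2^\alpha\le b<2^{\alpha+1}$ (and $0$ for $b=0$); $\alpha[\ell-1],\dots,\alpha[0]$ are its bits. **Hybrid model.** There is one statically corrupted malicious party, controlled by an arbitrary, computationally unbounded, randomized adversary. The honest parties compute locally (linear operations on shares; public constants $c$ are shared as $(c,0,0)$) and call ideal functionalities: * $\mathcal F_{\mathsf{Mult}}$ (with public $d$): receives from each party what it holds of $x,y$; aborts if these shares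 are inconsistent; otherwise generates uniformly random shares of $x\cdot_d y$, gives the corrupted party its part, and then the adversary decides if the honest parties receive theirs or all abort. * $\mathcal F_{\mathsf{Pow}}$: receives from each party what it holds of $b$, and from the adversary an index $k\in\{0,\dots,\ell-1\}$; aborts if the shares are inconsistent; otherwise sends the bits $\alpha[\ell-1],\dots,\alpha[k]$ of the bounding power $\alpha$ of $b$ to all parties, and then aborts if $k\neq 0$. * $\mathcal F_{\mathsf{Prep}}$: hands out preprocessing material (zero sharings, truncation pairs, shared random bits and the like); the two protocols below do not call it themselves. **Division.** For a public integer $\alpha\ge0$ put $p=\alpha+1$ (the ring element $b$ then stands for $b/2^{p}$). $\Pi_{\mathsf{Div}}$, on shares of $a,b$, calls $\mathcal F_{\mathsf{Pow}}$ on $b$ to get $\alpha$, and computes, with linear operations and calls of $\mathcal F_{\mathsf{Mult}}$, $w_0=[2.9142]_p-2b$, $\epsilon_0=[1]_p-b\cdot_p w_0$, $\epsilon_1=\epsilon_0\cdot_p\epsilon_0$, $\mathsf{AppDiv}(b)=(w_0\cdot_p([1]_p+\epsilon_0))\cdot_p([1]_p+\epsilon_1)$, and then returns shares of $a\cdot\mathsf{AppDiv}(b)$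 with $f$ bits of precision, i.e. of $\mathsf{AppDiv}(b)\cdot_{\max(2p-f,0)}\bigl(2^{\max(f-2p,0)}a\bigr)$. **Batch normalization.** $\Pi_{\mathsf{BN}}$, on shares of $a_1,\dots,a_m,\gamma,\beta$, computes likewise $\mu=[1/m]_f\cdot_f\sum_j a_j$ and $b=[1/m]_f\cdot_f\sum_j (a_j-\mu)\cdot_f(a_j-\mu)+[\varepsilon]_f$, calls $\mathcal F_{\mathsf{Pow}}$ on $b$ to get $\alpha$, starts from the public $x_0=\bigl[2^{-\lfloor(\alpha-f)/2\rceil}\bigr]_f$ (rounding to the nearest integer, $\alpha-f$ being the bounding power of the number $b/2^f$ that $b$ stands for), makes four Newton steps $x_{n+1}=x_n\cdot_{f+1}\bigl([3]_f-b\cdot_f(x_n\cdot_f x_n)\bigr)$ (a fixed-point form of $\frac{x_n}{2}(3-bx_n^2)$), and returns shares of $(\gamma\cdot_f x_4)\cdot_f(a_i-\mu)+\beta$ for $i=1,\dots,m$. **Ideal functionalities with abort.** $\mathcal F_{\mathsf{Div}}$ (respectively $\mathcal F_{\mathsf{BN}}$) receives from each party what it holds of the inputs, and from the adversary an index $k\in\{0,\dots,\ell-1\}$;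 it aborts if the shares are inconsistent. Otherwise it reconstructs the inputs, computes the bounding power $\alpha$ of $b$ (respectively of $b=\sigma^2+\varepsilon$ as above), and sends $\alpha[\ell-1],\dots,\alpha[k]$ to all parties. If $k\ne0$ it then aborts. If $k=0$ it generates uniformly random shares of $a\cdot\mathsf{AppDiv}(b)$ (respectively of the $m$ batch-normalized values), with the formulas above. The adversary may obtain the corrupted party's output shares before it decides whether the honest parties receive theirs, and it may make the functionality abort at any time before that delivery. **Theorem.** $\Pi_{\mathsf{Div}}$ and $\Pi_{\mathsf{BN}}$ securely realize $\mathcal F_{\mathsf{Div}}$ and $\mathcal F_{\mathsf{BN}}$ respectively, with abort, in the presence of one malicious party, in the $(\mathcal F_{\mathsf{Mult}},\mathcal F_{\mathsf{Pow}},\mathcal F_{\mathsf{Prep}})$-hybrid model. That is, for each of the two protocols and each corrupted party $P_i$ there is a straight-line black-box simulator, given only what $P_i$ holds of the inputs, such that for all consistent shares of the inputs and for every adversary, the joint distribution of the adversary's view, of what the honest parties receive in the clear, and of the honest parties' outputs (shares, or abort) is exactly the same in the execution of the protocol in the hybrid model and in the interaction of simulator, adversary and ideal functionality. -/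

import Mathlib

namespace Falcon

/-! ### Fixed-point arithmetic in the ring of integers modulo `2 ^ ℓ` -/

/-- The ring `ℤ_L`, `L = 2 ^ ℓ`. -/
abbrev Ring2 (ℓ : ℕ) : Type := ZMod (2 ^ ℓ)

/-- Two's complement reading of a ring element: the first half of the residues is nonnegative,
the second half is negative. -/
def signed {ℓ : ℕ} (z : Ring2 ℓ) : ℤ :=
  if 2 * z.val < 2 ^ ℓ then (z.val : ℤ) else (z.val : ℤ) - 2 ^ ℓ

/-- Exact truncation by `d` bits (arithmetic right shift). -/
def trunc {ℓ : ℕ} (d : ℕ) (z : Ring2 ℓ) : Ring2 ℓ := ((signed z / 2 ^ d : ℤ) : Ring2 ℓ)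

/-- Fixed-point multiplication: product in the ring, followed by truncation by `d` bits. -/
def fmul {ℓ : ℕ} (d : ℕ) (x y : Ring2 ℓ) : Ring2 ℓ := trunc d (x * y)

/-- Encoding of a rational constant with `d` bits of precision. -/
def encode (ℓ d : ℕ) (q : ℚ) : Ring2 ℓ := ((⌊q * 2 ^ d⌋ : ℤ) : Ring2 ℓ)

/-- The bounding power of `b`: the `α` with `2 ^ α ≤ b < 2 ^ (α + 1)`, where `b` is read as an
integer in `[0, 2 ^ ℓ)`; for `b = 0`, where there is no such `α`, the value is `0`. -/
def boundPow {ℓ : ℕ} (b : Ring2 ℓ) : ℕ := Nat.log 2 b.val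

theorem boundPow_spec {ℓ : ℕ} (b : Ring2 ℓ) (hb : b ≠ 0) :
    2 ^ boundPow b ≤ b.val ∧ b.val < 2 ^ (boundPow b + 1) := by
  have hv : b.val ≠ 0 := by
    intro h
    exact hb ((ZMod.val_eq_zero b).1 h)
  exact ⟨Nat.pow_log_le_self 2 hv, Nat.lt_pow_succ_log_self (by norm_num) _⟩

/-! ### The plaintext functions -/

/-- `AppDiv b = w₀ (1 + ε₀) (1 + ε₁)` with `w₀ = 2.9142 - 2 x`, `ε₀ = 1 - x w₀`, `ε₁ = ε₀ ^ 2`.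
Here `x = b / 2 ^ (α + 1) ∈ [1/2, 1)`, i.e. `x` is the ring element `b` read with `α + 1` bits of
precision, and the result is an approximation of `1 / x` with `α + 1` bits of precision. -/
def appDiv {ℓ : ℕ} (b : Ring2 ℓ) : Ring2 ℓ :=
  let p := boundPow b + 1
  let one := encode ℓ p 1
  let w₀ := encode ℓ p 2.9142 - 2 * b
  let ε₀ := one - fmul p b w₀
  let ε₁ := fmul p ε₀ ε₀
  fmul p (fmul p w₀ (one + ε₀)) (one + ε₁)

/-- `a * AppDiv b` as a number with `f` bits of precision, for `a`, `b` with `f` bits of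
precision: since `b / 2 ^ f = x * 2 ^ (α + 1 - f)`, the product of the ring elements has to be
scaled by `2 ^ (f - 2 (α + 1))`.  (Of the two truncated subtractions at least one vanishes.) -/
def divValue {ℓ : ℕ} (f : ℕ) (a b : Ring2 ℓ) : Ring2 ℓ :=
  let p := boundPow b + 1
  fmul (2 * p - f) (appDiv b) ((2 : Ring2 ℓ) ^ (f - 2 * p) * a)

/-- The mean `μ = 1/m * ∑ aᵢ`. -/
def bnMean {ℓ m : ℕ} (f : ℕ) (a : Fin m → Ring2 ℓ) : Ring2 ℓ :=
  fmul f (encode ℓ f (1 / m)) (∑ j, a j)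

/-- `b = σ ^ 2 + ε`, where `σ ^ 2 = 1/m * ∑ (aᵢ - μ) ^ 2`. -/
def bnScale {ℓ m : ℕ} (f : ℕ) (ε : ℚ) (a : Fin m → Ring2 ℓ) : Ring2 ℓ :=
  let μ := bnMean f a
  fmul f (encode ℓ f (1 / m)) (∑ j, fmul f (a j - μ) (a j - μ)) + encode ℓ f ε

/-- The initial guess for `1 / √b`, a power of two, from the bounding power `α` of the ring
element `b`.  The number that `b` stands for is `b / 2 ^ f`, whose bounding power is `α - f`. -/
def bnInit (ℓ f α : ℕ) : Ring2 ℓ :=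
  encode ℓ f ((2 : ℚ) ^ (-round (((α : ℚ) - f) / 2)))

/-- `n` Newton steps `x ↦ (x / 2) (3 - b x ^ 2)`; the halving is one more bit of truncation. -/
def newton {ℓ : ℕ} (f : ℕ) (b : Ring2 ℓ) : ℕ → Ring2 ℓ → Ring2 ℓ
  | 0, x => x
  | n + 1, x => newton f b n (fmul (f + 1) x (encode ℓ f 3 - fmul f b (fmul f x x)))

/-- Batch normalization: `γ * x₄ * (aᵢ - μ) + β` for all `i`, with `x₄ ≈ 1 / √(σ ^ 2 + ε)` the
result of four Newton steps. -/
def bnValue {ℓ m : ℕ} (f : ℕ) (ε : ℚ) (a : Fin m → Ring2 ℓ) (γ β : Ring2 ℓ) (j : Fin m) :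
    Ring2 ℓ :=
  let μ := bnMean f a
  let b := bnScale f ε a
  let x := newton f b 4 (bnInit ℓ f (boundPow b))
  fmul f (fmul f γ x) (a j - μ) + β

/-! ### Replicated secret sharing among three parties -/

/-- What a single party holds of a sharing `(s₀, s₁, s₂)`. -/
abbrev Held (n : ℕ) : Type := ZMod n × ZMod n

/-- Party `i` holds the `i`-th and the next share. -/
def held {n : ℕ} (s : Fin 3 → ZMod n) (i : Fin 3) : Held n := (s i, s (i + 1))

/-- The pairs submitted by the three parties agree on every share that is held twice. -/
def Consistent {n : ℕ} (t : Fin 3 → Held n) : Prop := ∀ i, (t i).2 = (t (i + 1)).1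

/-- The secret. -/
def recon {n : ℕ} (t : Fin 3 → Held n) : ZMod n := ∑ i, (t i).1

/-- Uniformly random sharing of `x`. -/
noncomputable def sharing {n : ℕ} [NeZero n] (x : ZMod n) : PMF (Fin 3 → ZMod n) :=
  (PMF.uniformOfFintype (ZMod n × ZMod n)).map fun r => ![r.1, r.2, x - r.1 - r.2]

/-- Independent uniformly random sharings of the entries of a vector. -/
noncomputable def sharings {n : ℕ} [NeZero n] {κ : Type} [Fintype κ] [DecidableEq κ]
    (x : κ → ZMod n) : PMF (κ → Fin 3 → ZMod n) :=
  (PMF.uniformOfFintype (κ → ZMod n × ZMod n)).map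
    fun r j => ![(r j).1, (r j).2, x j - (r j).1 - (r j).2]

/-- A public constant `c`, shared as `(c, 0, 0)`. -/
def pub {n : ℕ} (i : Fin 3) (c : ZMod n) : Held n := held ![c, 0, 0] i

/-- The triple with entry `u` at `i`, `v` at `i + 1` and `w` at `i + 2`. -/
def gather {T : Type} (i : Fin 3) (u v w : T) : Fin 3 → T :=
  fun j => if j = i then u else if j = i + 1 then v else w

/-! ### The functionalities of the hybrid model -/

/-- Fixed-point multiplication `F_Mult`: from the pairs held by the three parties, fresh random
shares of the truncated product; `none` is an abort because of inconsistent inputs. -/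
noncomputable def multF {ℓ : ℕ} (d : ℕ) (x y : Fin 3 → Held (2 ^ ℓ)) :
    Option (PMF (Fin 3 → Ring2 ℓ)) :=
  open Classical in
  if Consistent x ∧ Consistent y then some (sharing (fmul d (recon x) (recon y))) else none

/-- Part of the binary expansion of a number: the known ones among `ℓ` bits. -/
abbrev Bits (ℓ : ℕ) : Type := Fin ℓ → Option Bool

/-- The bits `α[ℓ - 1], …, α[k]` of `α`. -/
def topBits {ℓ : ℕ} (α : ℕ) (k : Fin ℓ) : Bits ℓ :=
  fun i => if k ≤ i then some (α.testBit i) else none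

/-- Bounding power `F_Pow`, with index `k` chosen by the adversary: all parties get the bits
`α[ℓ - 1], …, α[k]` (first component); if `k = 0` this is all of `α`, with which the parties go
on (second component), and if `k ≠ 0` the functionality then aborts.  The outer `none` is an
abort because of inconsistent inputs. -/
noncomputable def powF {ℓ : ℕ} (b : Fin 3 → Held (2 ^ ℓ)) (k : Fin ℓ) :
    Option (Bits ℓ × Option ℕ) :=
  open Classical in
  if Consistent b then
    let α := boundPow (recon b)
    some (topBits α k, if (k : ℕ) = 0 then some α else none)
  else none

/-- The kinds of preprocessing material: 3-out-of-3 and 2-out-of-3 zero randomness, truncation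
pairs, and the correlated randomness for private compare, for the wrap function and for ReLU. -/
inductive PrepReq : Type
  | zeroThree
  | zeroTwo
  | truncPair (d : ℕ)
  | compare
  | wrap
  | relu

/-- The small prime modulus. -/
abbrev smallPrime : ℕ := 37

instance : Nonempty {u : ZMod smallPrime // u ≠ 0} := ⟨⟨1, by decide⟩⟩

/-- What one party gets of each kind of preprocessing material. -/
def Material (ℓ : ℕ) : PrepReq → Type
  | .zeroThree => Ring2 ℓ
  | .zeroTwo => Held (2 ^ ℓ)
  | .truncPair _ => Held (2 ^ ℓ) × Held (2 ^ ℓ)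
  | .compare => Held 2 × Held smallPrime × Held smallPrime
  | .wrap => Held (2 ^ ℓ) × (Fin ℓ → Held smallPrime) × Held 2
  | .relu => Held 2 × Held (2 ^ ℓ)

/-- Preprocessing `F_Prep`.
* `zeroThree`: random `α₀ + α₁ + α₂ = 0`, of which party `i` gets `αᵢ`;
* `zeroTwo`: the same, but party `i` gets `(αᵢ, αᵢ₊₁)`;
* `truncPair d`: shares of a random `r` and of `r / 2 ^ d`;
* `compare`: shares of a random bit in two rings, and of a random unit modulo the small prime;
* `wrap`: shares `xᵢ` of a random `x`, shares of the bits of `x` modulo the small prime, and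
  shares modulo `2` of the number of wraps in `x₀ + x₁ + x₂`;
* `relu`: shares of a random bit in two rings. -/
noncomputable def prepF (ℓ : ℕ) : (q : PrepReq) → PMF (Fin 3 → Material ℓ q)
  | .zeroThree => (sharing (n := 2 ^ ℓ) 0).map fun s i => (s i : Ring2 ℓ)
  | .zeroTwo => (sharing (n := 2 ^ ℓ) 0).map fun s i => held s i
  | .truncPair d => do
      let r ← PMF.uniformOfFintype (Ring2 ℓ)
      let s ← sharing r
      let t ← sharing (trunc d r)
      pure fun i => (held s i, held t i)
  | .compare => do
      let c ← PMF.uniformOfFintype Bool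
      let s ← sharing (n := 2) (c.toNat : ZMod 2)
      let t ← sharing (n := smallPrime) (c.toNat : ZMod smallPrime)
      let u ← PMF.uniformOfFintype {u : ZMod smallPrime // u ≠ 0}
      let v ← sharing u.1
      pure fun i => (held s i, held t i, held v i)
  | .wrap => do
      let x ← PMF.uniformOfFintype (Ring2 ℓ)
      let s ← sharing x
      let t ← sharings (n := smallPrime) fun j : Fin ℓ =>
        ((x.val.testBit j).toNat : ZMod smallPrime)
      let w ← sharing (n := 2) (((∑ i, (s i).val) / 2 ^ ℓ : ℕ) : ZMod 2)
      pure fun i => (held s i, fun j => held (t j) i, held w i)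
  | .relu => do
      let c ← PMF.uniformOfFintype Bool
      let s ← sharing (n := 2) (c.toNat : ZMod 2)
      let t ← sharing (n := 2 ^ ℓ) (c.toNat : Ring2 ℓ)
      pure fun i => (held s i, held t i)

/-! ### Protocols in the hybrid model -/

/-- Code of one party: local computation and calls of the functionalities. -/
inductive Prog (ℓ : ℕ) (T : Type) : Type
  | ret (a : T)
  | mult (d : ℕ) (x y : Held (2 ^ ℓ)) (next : Held (2 ^ ℓ) → Prog ℓ T)
  | pow (b : Held (2 ^ ℓ)) (next : ℕ → Prog ℓ T)
  | prep (q : PrepReq) (next : Material ℓ q → Prog ℓ T)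

/-- Sequential composition of code. -/
def Prog.bind {ℓ : ℕ} {T U : Type} : Prog ℓ T → (T → Prog ℓ U) → Prog ℓ U
  | .ret a, g => g a
  | .mult d x y next, g => .mult d x y fun z => (next z).bind g
  | .pow b next, g => .pow b fun α => (next α).bind g
  | .prep q next, g => .prep q fun z => (next z).bind g

instance {ℓ : ℕ} : Monad (Prog ℓ) where
  pure := Prog.ret
  bind := Prog.bind

/-- Call of `F_Mult`. -/
def callMult {ℓ : ℕ} (d : ℕ) (x y : Held (2 ^ ℓ)) : Prog ℓ (Held (2 ^ ℓ)) := .mult d x y .ret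

/-- Call of `F_Pow`. -/
def callPow {ℓ : ℕ} (b : Held (2 ^ ℓ)) : Prog ℓ ℕ := .pow b .ret

/-- For-loop that collects its results. -/
def Prog.collect {ℓ : ℕ} {T : Type} : (n : ℕ) → (Fin n → Prog ℓ T) → Prog ℓ (Fin n → T)
  | 0, _ => pure Fin.elim0
  | n + 1, g => do
      let x ← g 0
      let y ← Prog.collect n fun j => g j.succ
      pure (Fin.cons x y)

/-- A protocol: code for every party, which starts from what the party holds of the shared
inputs, and ends with what it holds of the shared outputs. -/
abbrev Protocol (ℓ : ℕ) (ι κ : Type) : Type :=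
  Fin 3 → (ι → Held (2 ^ ℓ)) → Prog ℓ (κ → Held (2 ^ ℓ))

/-- The division protocol `Π_Div`; the inputs are `a` (index `0`) and `b` (index `1`). -/
def divProtocol (ℓ f : ℕ) : Protocol ℓ (Fin 2) Unit := fun i x => do
  let a := x 0
  let b := x 1
  let α ← callPow b
  let p := α + 1
  let one := pub i (encode ℓ p 1)
  let w₀ := pub i (encode ℓ p 2.9142) - (2 : Ring2 ℓ) • b
  let t ← callMult p b w₀
  let ε₀ := one - t
  let ε₁ ← callMult p ε₀ ε₀
  let u ← callMult p w₀ (one + ε₀)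
  let v ← callMult p u (one + ε₁)
  let z ← callMult (2 * p - f) v ((2 : Ring2 ℓ) ^ (f - 2 * p) • a)
  pure fun _ => z

/-- `n` Newton steps on shares. -/
def newtonProg {ℓ : ℕ} (f : ℕ) (i : Fin 3) (b : Held (2 ^ ℓ)) :
    ℕ → Held (2 ^ ℓ) → Prog ℓ (Held (2 ^ ℓ))
  | 0, x => pure x
  | n + 1, x => do
      let s ← callMult f x x
      let t ← callMult f b s
      let y ← callMult (f + 1) x (pub i (encode ℓ f 3) - t)
      newtonProg f i b n y

/-- The batch-normalization protocol `Π_BN`; the inputs are `a₁, …, a_m` (indices `inl j`), `γ`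
(index `inr 0`) and `β` (index `inr 1`). -/
def bnProtocol (ℓ f m : ℕ) (ε : ℚ) : Protocol ℓ (Fin m ⊕ Fin 2) (Fin m) := fun i x => do
  let a := fun j : Fin m => x (.inl j)
  let γ := x (.inr 0)
  let β := x (.inr 1)
  let c := pub i (encode ℓ f (1 / m))
  let μ ← callMult f c (∑ j, a j)
  let s ← Prog.collect m fun j => callMult f (a j - μ) (a j - μ)
  let v ← callMult f c (∑ j, s j)
  let b := v + pub i (encode ℓ f ε)
  let α ← callPow b
  let y ← newtonProg f i b 4 (pub i (bnInit ℓ f α))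
  let g ← callMult f γ y
  let z ← Prog.collect m fun j => callMult f g (a j - μ)
  pure fun j => z j + β

/-! ### The adversary and the execution in the hybrid model -/

/-- Messages to the adversary: the honest parties call a functionality, or a functionality hands
the corrupted party its part of the output. -/
inductive ToAdv (ℓ : ℕ) : Type
  | multCall (d : ℕ)
  | multOut (z : Held (2 ^ ℓ))
  | powCall
  | powOut (l : Bits ℓ)
  | prepCall (q : PrepReq)
  | prepOut (q : PrepReq) (z : Material ℓ q)

/-- Messages of the adversary: inputs of the corrupted party to a functionality, consent to the
delivery of outputs to the honest parties, or abort. -/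
inductive FromAdv (ℓ : ℕ) : Type
  | multIn (x y : Held (2 ^ ℓ))
  | powIn (b : Held (2 ^ ℓ)) (k : Fin ℓ)
  | prepIn (q : PrepReq)
  | deliver
  | abort

/-- The view of the adversary, together with its own messages. -/
abbrev View (ℓ : ℕ) : Type := List (ToAdv ℓ × FromAdv ℓ)

/-- An adversary: arbitrary, computationally unbounded and randomized.  It chooses its next
message from the view so far and the message that has just arrived. -/
abbrev Adversary (ℓ : ℕ) : Type := View ℓ → ToAdv ℓ → PMF (FromAdv ℓ)

/-- Joint result of an execution: the view of the adversary; what the honest parties received in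
the clear from a functionality; and what the two honest parties output, `none` if they abort. -/
abbrev Joint (ℓ : ℕ) (T : Type) : Type := View ℓ × List (Bits ℓ) × Option (T × T)

/-- Execution with corrupted party `i` and adversary `A`.  The two programs are those of the
honest parties `i + 1` and `i + 2`.  A functionality runs when both honest parties call it; it
then asks the corrupted party for its inputs.  `F_Mult` and `F_Prep` hand the corrupted party its
part of the output first, and the adversary then decides if the honest parties receive theirs.
Whenever the adversary does not answer with the message that is due, this counts as an abort. -/
noncomputable def exec {ℓ : ℕ} {T : Type} (i : Fin 3) (A : Adversary ℓ) :
    Prog ℓ T → Prog ℓ T → View ℓ → List (Bits ℓ) → PMF (Joint ℓ T)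
  | .ret a, .ret a', h, c => PMF.pure (h, c, some (a, a'))
  | .mult d x y next, .mult d' x' y' next', h, c =>
      if d = d' then
        (A h (.multCall d)).bind fun r =>
          let h₁ := h ++ [(.multCall d, r)]
          match r with
          | .multIn u v =>
            match multF d (gather i u x x') (gather i v y y') with
            | some D => D.bind fun z =>
                (A h₁ (.multOut (held z i))).bind fun r₂ =>
                  let h₂ := h₁ ++ [(.multOut (held z i), r₂)]
                  match r₂ with
                  | .deliver => exec i A (next (held z (i + 1))) (next' (held z (i + 2))) h₂ c
                  | _ => PMF.pure (h₂, c, none)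
            | none => PMF.pure (h₁, c, none)
          | _ => PMF.pure (h₁, c, none)
      else PMF.pure (h, c, none)
  | .pow b next, .pow b' next', h, c =>
      (A h .powCall).bind fun r =>
        let h₁ := h ++ [(.powCall, r)]
        match r with
        | .powIn u k =>
          match powF (gather i u b b') k with
          | some (l, res) =>
            (A h₁ (.powOut l)).bind fun r₂ =>
              let h₂ := h₁ ++ [(.powOut l, r₂)]
              match res with
              | some α => exec i A (next α) (next' α) h₂ (c ++ [l])
              | none => PMF.pure (h₂, c ++ [l], none)
          | none => PMF.pure (h₁, c, none)
        | _ => PMF.pure (h₁, c, none)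
  | .prep q next, .prep q' next', h, c =>
      open Classical in
      if hq : q = q' then
        (A h (.prepCall q)).bind fun r =>
          let h₁ := h ++ [(.prepCall q, r)]
          if r = .prepIn q then
            (prepF ℓ q).bind fun z =>
              (A h₁ (.prepOut q (z i))).bind fun r₂ =>
                let h₂ := h₁ ++ [(.prepOut q (z i), r₂)]
                match r₂ with
                | .deliver => exec i A (next (z (i + 1))) (next' (hq ▸ z (i + 2))) h₂ c
                | _ => PMF.pure (h₂, c, none)
          else PMF.pure (h₁, c, none)
      else PMF.pure (h, c, none)
  | _, _, h, c => PMF.pure (h, c, none)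

/-- Hybrid execution of a protocol, started from a sharing `s` of the inputs. -/
noncomputable def hybridExec {ℓ : ℕ} {ι κ : Type} (P : Protocol ℓ ι κ) (i : Fin 3)
    (s : ι → Fin 3 → Ring2 ℓ) (A : Adversary ℓ) : PMF (Joint ℓ (κ → Held (2 ^ ℓ))) :=
  exec i A (P (i + 1) fun j => held (s j) (i + 1)) (P (i + 2) fun j => held (s j) (i + 2)) [] []

/-! ### The ideal model -/

/-- An ideal functionality that leaks a bounding power: from the reconstructed inputs `x` it
leaks the bounding power of `scale x`, and it outputs shares of `value x`. -/
structure IdealF (ℓ : ℕ) (ι κ : Type) where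
  scale : (ι → Ring2 ℓ) → Ring2 ℓ
  value : (ι → Ring2 ℓ) → κ → Ring2 ℓ

/-- `F_Div`. -/
def divF (ℓ f : ℕ) : IdealF ℓ (Fin 2) Unit where
  scale x := x 1
  value x _ := divValue f (x 0) (x 1)

/-- `F_BN`. -/
def bnF (ℓ f m : ℕ) (ε : ℚ) : IdealF ℓ (Fin m ⊕ Fin 2) (Fin m) where
  scale x := bnScale f ε fun j => x (.inl j)
  value x := bnValue f ε (fun j => x (.inl j)) (x (.inr 0)) (x (.inr 1))

/-- Requests of the simulator to the functionality: the inputs of the corrupted party together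
with the index `k`; the output shares of the corrupted party; delivery of their output shares to
the honest parties; abort. -/
inductive IdealReq (ℓ : ℕ) (ι : Type) : Type
  | inputs (x : ι → Held (2 ^ ℓ)) (k : Fin ℓ)
  | output
  | deliver
  | abort

/-- Replies of the functionality to the simulator. -/
inductive IdealReply (ℓ : ℕ) (κ : Type) : Type
  | leak (l : Bits ℓ)
  | shares (z : κ → Held (2 ^ ℓ))
  | delivered
  | aborted

/-- Phase of the functionality: waiting for the inputs of the corrupted party; output computed;
output delivered to the honest parties; aborted. -/
inductive Phase (ℓ : ℕ) (κ : Type) : Type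
  | waiting
  | computed (y : κ → Fin 3 → Ring2 ℓ)
  | delivered (y : κ → Fin 3 → Ring2 ℓ)
  | aborted

/-- State of the functionality: what has been sent to all parties in the clear, and the phase. -/
structure IdealState (ℓ : ℕ) (κ : Type) where
  clear : List (Bits ℓ)
  phase : Phase ℓ κ

/-- One step of the functionality, where `s` is the sharing of the inputs that the honest parties
`i + 1` and `i + 2` hold, and of which they have sent their pairs to the functionality. -/
noncomputable def IdealF.step {ℓ : ℕ} {ι κ : Type} [Fintype κ] [DecidableEq κ]
    (F : IdealF ℓ ι κ) (i : Fin 3) (s : ι → Fin 3 → Ring2 ℓ) (st : IdealState ℓ κ)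
    (r : IdealReq ℓ ι) : PMF (IdealState ℓ κ × IdealReply ℓ κ) :=
  match st.phase, r with
  | .waiting, .inputs u k =>
      let t := fun j => gather i (u j) (held (s j) (i + 1)) (held (s j) (i + 2))
      open Classical in
      if ∀ j, Consistent (t j) then
        let x := fun j => recon (t j)
        let l := topBits (boundPow (F.scale x)) k
        if (k : ℕ) = 0 then
          (sharings (F.value x)).map fun y => (⟨st.clear ++ [l], .computed y⟩, .leak l)
        else PMF.pure (⟨st.clear ++ [l], .aborted⟩, .leak l)
      else PMF.pure (⟨st.clear, .aborted⟩, .aborted)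
  | .computed y, .output => PMF.pure (st, .shares fun j => held (y j) i)
  | .computed y, .deliver => PMF.pure (⟨st.clear, .delivered y⟩, .delivered)
  | .delivered _, _ => PMF.pure (st, .delivered)
  | _, _ => PMF.pure (⟨st.clear, .aborted⟩, .aborted)

/-- A straight-line black-box simulator: a randomized interactive machine that talks to the
functionality and to the adversary, and does not rewind the latter. -/
inductive Simulator (ℓ : ℕ) (ι κ : Type) : Type 1
  | halt
  | sample {Ω : Type} (D : PMF Ω) (next : Ω → Simulator ℓ ι κ)
  | adversary (q : ToAdv ℓ) (next : FromAdv ℓ → Simulator ℓ ι κ)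
  | functionality (r : IdealReq ℓ ι) (next : IdealReply ℓ κ → Simulator ℓ ι κ)

/-- What the honest parties output: their shares once these are delivered, and abort otherwise. -/
def IdealState.honestOutput {ℓ : ℕ} {κ : Type} (i : Fin 3) (st : IdealState ℓ κ) :
    Option ((κ → Held (2 ^ ℓ)) × (κ → Held (2 ^ ℓ))) :=
  match st.phase with
  | .delivered y => some (fun j => held (y j) (i + 1), fun j => held (y j) (i + 2))
  | _ => none

/-- Interaction of simulator, functionality and adversary. -/
noncomputable def Simulator.run {ℓ : ℕ} {ι κ : Type} [Fintype κ] [DecidableEq κ]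
    (F : IdealF ℓ ι κ) (i : Fin 3) (s : ι → Fin 3 → Ring2 ℓ) (A : Adversary ℓ) :
    Simulator ℓ ι κ → IdealState ℓ κ → View ℓ → PMF (Joint ℓ (κ → Held (2 ^ ℓ)))
  | .halt, st, h => PMF.pure (h, st.clear, st.honestOutput i)
  | .sample D next, st, h => D.bind fun ω => Simulator.run F i s A (next ω) st h
  | .adversary q next, st, h =>
      (A h q).bind fun r => Simulator.run F i s A (next r) st (h ++ [(q, r)])
  | .functionality r next, st, h =>
      (F.step i s st r).bind fun p => Simulator.run F i s A (next p.2) p.1 h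

/-- Ideal execution, where the honest parties hold their part of the sharing `s`, and the
simulator starts from the part of the corrupted party. -/
noncomputable def idealExec {ℓ : ℕ} {ι κ : Type} [Fintype κ] [DecidableEq κ]
    (F : IdealF ℓ ι κ) (i : Fin 3) (S : (ι → Held (2 ^ ℓ)) → Simulator ℓ ι κ)
    (s : ι → Fin 3 → Ring2 ℓ) (A : Adversary ℓ) : PMF (Joint ℓ (κ → Held (2 ^ ℓ))) :=
  Simulator.run F i s A (S fun j => held (s j) i) ⟨[], .waiting⟩ []

/-- `P` securely realizes `F` with abort, in the presence of one malicious party, in the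
`(F_Mult, F_Pow, F_Prep)`-hybrid model: perfectly, and with a straight-line black-box simulator.
As `A` is quantified after the sharing `s`, it may depend on all inputs (in particular, it knows
the input of the corrupted party), while the simulator knows only the corrupted party's part. -/
def SecurelyRealizes {ℓ : ℕ} {ι κ : Type} [Fintype κ] [DecidableEq κ]
    (P : Protocol ℓ ι κ) (F : IdealF ℓ ι κ) : Prop :=
  ∀ i : Fin 3, ∃ S : (ι → Held (2 ^ ℓ)) → Simulator ℓ ι κ,
    ∀ (s : ι → Fin 3 → Ring2 ℓ) (A : Adversary ℓ), hybridExec P i s A = idealExec F i S s A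

end Falcon

namespace Falcon

/-! A replicated sharing of a given secret is determined by the pair of any one party, and in a
uniformly random sharing this pair is uniform whatever the secret (`sharing_eq_map_gather`). So
uniform pairs simulate the outputs of `F_Mult` exactly, and once such a pair is fixed the honest
shares carry no further randomness. Conversely, the honest parties together hold all three shares,
so a consistency check passes only if the corrupted party submits exactly the pair it should hold
(`Shares.consistent_gather_iff`). The simulator knows this pair by running the corrupted party's
code on its inputs and on the pairs handed out so far; it halts on any other submission, just as the
hybrid execution aborts.

`Lockstep` expresses that the code yields sharings of the right plaintext values whatever random
shares occur. Hence `F_Pow` leaks the same bits as the ideal functionality, to which the simulator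
forwards the index `k`.

The outputs need more care, because the honest output shares belong to the joint distribution. Each
output is a product from `F_Mult` plus an already fixed sharing of an offset, and such a sum is
again a uniformly random sharing (`sharings_eq_map_add`). The simulator therefore requests the
corrupted party's output pairs, subtracts its offset pairs, and presents the differences as outputs
of the last multiplications. The functionality draws the output shares already when the bounding
power is leaked; this is harmless, since independent draws commute and an abort discards the drawn
shares. -/

/-! ### Uniformly random sharings -/

theorem map_equiv_uniformOfFintype {X Y : Type} [Fintype X] [Nonempty X] [Fintype Y] [Nonempty Y]
    (e : X ≃ Y) :
    (PMF.uniformOfFintype X).map e = PMF.uniformOfFintype Y := by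
  ext y
  rw [PMF.map_apply, tsum_eq_single (e.symm y)]
  · simp [Fintype.card_congr e]
  · intro x hx
    rw [if_neg]
    rintro rfl
    simp at hx

theorem gather_held {n : ℕ} (i : Fin 3) (z : Fin 3 → ZMod n) :
    gather i (held z i) (held z (i + 1)) (held z (i + 2)) = held z := by
  funext j
  fin_cases i <;> fin_cases j <;> rfl

theorem held_gather {n : ℕ} (i : Fin 3) (a b c : ZMod n) : held (gather i a b c) i = (a, b) := by
  fin_cases i <;> rfl

theorem sum_gather {n : ℕ} (i : Fin 3) (a b c : ZMod n) :
    ∑ j, gather i a b c j = a + b + c := by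
  fin_cases i <;> simp [gather, Fin.sum_univ_three] <;> abel

/-- The random pair of a uniformly random sharing of `x` may be taken to be the pair that
party `i` holds. -/
theorem sharing_eq_map_gather {n : ℕ} [NeZero n] (i : Fin 3) (x : ZMod n) :
    sharing x = (PMF.uniformOfFintype (Held n)).map
      fun r => gather i r.1 r.2 (x - r.1 - r.2) := by
  -- With the secret fixed, any two of the three shares determine the third; `e` passes from shares
  -- `i`, `i + 1` to shares `0`, `1`.
  let e : Held n ≃ ZMod n × ZMod n :=
    { toFun := fun r => (gather i r.1 r.2 (x - r.1 - r.2) 0, gather i r.1 r.2 (x - r.1 - r.2) 1)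
      invFun := fun r => held ![r.1, r.2, x - r.1 - r.2] i
      left_inv := fun r => by
        fin_cases i <;> ext <;> (simp [gather, held] <;> ring)
      right_inv := fun r => by
        fin_cases i <;> ext <;> (simp [gather, held] <;> ring) }
  conv_lhs => rw [sharing, ← map_equiv_uniformOfFintype e, PMF.map_comp]
  congr 1
  funext r j
  fin_cases i <;> fin_cases j <;> simp [gather, held, e] <;> ring

theorem sharings_zero {n : ℕ} [NeZero n] (x : Fin 0 → ZMod n) :
    sharings x = PMF.pure Fin.elim0 := by
  rw [sharings, ← PMF.map_const (PMF.uniformOfFintype (Fin 0 → ZMod n × ZMod n))]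
  congr 1
  funext r
  exact Subsingleton.elim _ _

theorem uniformOfFintype_prod {X Y : Type} [Fintype X] [Nonempty X] [Fintype Y] [Nonempty Y] :
    PMF.uniformOfFintype (X × Y) =
      (PMF.uniformOfFintype X).bind fun a => (PMF.uniformOfFintype Y).map fun b => (a, b) := by
  classical
  ext ⟨a, b⟩
  rw [PMF.bind_apply, tsum_eq_single a, PMF.map_apply, tsum_eq_single b]
  · simp [Fintype.card_prod, ENNReal.mul_inv]
  · intro b' hb
    rw [if_neg]
    rintro ⟨⟩
    exact hb rfl
  · intro a' ha
    rw [PMF.map_apply, ENNReal.tsum_eq_zero.2, mul_zero]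
    intro b'
    rw [if_neg]
    rintro ⟨⟩
    exact ha rfl

/-- Matches the joint draw of all output shares by the ideal functionality with the call-by-call
draws of `F_Mult`. -/
theorem sharings_succ {n m : ℕ} [NeZero n] (x : Fin (m + 1) → ZMod n) :
    sharings x = (sharing (x 0)).bind fun z =>
      (sharings fun j => x (Fin.succ j)).map (Fin.cons z) := by
  rw [sharings, ← map_equiv_uniformOfFintype (Fin.consEquiv fun _ => ZMod n × ZMod n),
    uniformOfFintype_prod, sharing, PMF.bind_map, PMF.map_bind, PMF.map_bind]
  congr 1
  funext r
  simp only [Function.comp_apply, sharings, PMF.map_comp]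
  congr 1
  funext r' j
  refine Fin.cases ?_ (fun j => ?_) j <;> simp [Fin.consEquiv]

/-- Reindexing of sharings, and addition of fixed sharings. -/
theorem sharings_eq_map_add {n : ℕ} [NeZero n] {κ κ' : Type} [Fintype κ] [DecidableEq κ]
    [Fintype κ'] [DecidableEq κ'] (e : κ ≃ κ') (x : κ → ZMod n) (v : κ' → ZMod n)
    (o : κ' → Fin 3 → ZMod n) (h : ∀ k, x k = v (e k) + ∑ i, o (e k) i) :
    sharings x = (sharings v).map fun z k => z (e k) + o (e k) := by
  -- Translating the random pair by the first two offset shares is a bijection; the third share then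
  -- fits because the secret grows by the sum of all three.
  let t : (κ' → ZMod n × ZMod n) ≃ (κ → ZMod n × ZMod n) :=
    (Equiv.arrowCongr e.symm (Equiv.refl _)).trans
      (Equiv.addRight fun k => (o (e k) 0, o (e k) 1))
  rw [sharings, ← map_equiv_uniformOfFintype t, sharings, PMF.map_comp, PMF.map_comp]
  congr 1
  funext r k j
  simp only [Function.comp_apply, h, Fin.sum_univ_three]
  fin_cases j <;> simp [t]
  ring

/-! ### Sharings held by three parties -/

/-- The pairs `t` form a sharing of `v`. -/
def Shares {n : ℕ} (v : ZMod n) (t : Fin 3 → Held n) : Prop := Consistent t ∧ recon t = v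

namespace Shares

variable {n : ℕ} {v w : ZMod n} {t u : Fin 3 → Held n}

theorem held (s : Fin 3 → ZMod n) : Shares (∑ i, s i) (Falcon.held s) := ⟨fun _ => rfl, rfl⟩

theorem eq_held (h : Consistent t) : t = Falcon.held fun i => (t i).1 :=
  funext fun i => Prod.ext rfl (h i)

theorem pub (c : ZMod n) : Shares c fun i => Falcon.pub i c := by
  refine ⟨fun i => ?_, ?_⟩
  · simp [Falcon.pub, Falcon.held]
  · simp [recon, Falcon.pub, Falcon.held, Fin.sum_univ_three]

theorem add (ht : Shares v t) (hu : Shares w u) : Shares (v + w) fun i => t i + u i := by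
  obtain ⟨ht, rfl⟩ := ht
  obtain ⟨hu, rfl⟩ := hu
  exact ⟨fun i => by simp [ht i, hu i], by simp [recon, Finset.sum_add_distrib]⟩

theorem sub (ht : Shares v t) (hu : Shares w u) : Shares (v - w) fun i => t i - u i := by
  obtain ⟨ht, rfl⟩ := ht
  obtain ⟨hu, rfl⟩ := hu
  exact ⟨fun i => by simp [ht i, hu i], by simp [recon, Finset.sum_sub_distrib]⟩

theorem smul (c : ZMod n) (ht : Shares v t) : Shares (c * v) fun i => c • t i := by
  obtain ⟨ht, rfl⟩ := ht
  exact ⟨fun i => by simp [ht i], by simp [recon, Finset.mul_sum]⟩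

theorem sum {m : ℕ} {v : Fin m → ZMod n} {t : Fin m → Fin 3 → Held n}
    (h : ∀ j, Shares (v j) (t j)) : Shares (∑ j, v j) fun i => ∑ j, t j i := by
  refine ⟨fun i => ?_, ?_⟩
  · simp [Prod.fst_sum, Prod.snd_sum, (h _).1 i]
  · rw [recon]
    simp only [Prod.fst_sum]
    rw [Finset.sum_comm]
    exact Finset.sum_congr rfl fun j _ => (h j).2

/-- Each share of party `i` is also held by an honest party: the first by `i + 2`, the second by `i
+ 1`. A corrupted party thus cannot alter its input unnoticed. -/
theorem consistent_gather_iff (ht : Consistent t) (i : Fin 3) (a : Held n) :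
    Consistent (gather i a (t (i + 1)) (t (i + 2))) ↔ a = t i := by
  constructor
  · intro h
    have h₀ := h i
    have h₂ := h (i + 2)
    have ht₀ := ht i
    have ht₂ := ht (i + 2)
    revert h₀ h₂ ht₀ ht₂
    fin_cases i <;> simp [gather, Prod.ext_iff] <;> grind
  · rintro rfl
    rw [eq_held ht, gather_held]
    exact fun _ => rfl

theorem gather_eq (ht : Consistent t) (i : Fin 3) :
    gather i (t i) (t (i + 1)) (t (i + 2)) = t := by
  rw [eq_held ht, gather_held]

end Shares

/-! ### Three parties running their code in lockstep -/

theorem Prog.bind_assoc {ℓ : ℕ} {T U V : Type} (p : Prog ℓ T) (g : T → Prog ℓ U)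
    (k : U → Prog ℓ V) : (p.bind g).bind k = p.bind fun t => (g t).bind k := by
  induction p with
  | ret a => rfl
  | mult d x y next ih => simp [Prog.bind, ih]
  | pow b next ih => simp [Prog.bind, ih]
  | prep q next ih => simp [Prog.bind, ih]

/-- The three parties call `F_Mult` in lockstep on consistent sharings (and call no other
functionality), and whatever shares they get, their results satisfy `R`. -/
inductive Lockstep {ℓ : ℕ} {T : Type} (R : (Fin 3 → T) → Prop) : (Fin 3 → Prog ℓ T) → Prop
  | ret (t : Fin 3 → T) (h : R t) : Lockstep R fun i => .ret (t i)
  | mult (d : ℕ) (x y : Fin 3 → Held (2 ^ ℓ)) (next : Fin 3 → Held (2 ^ ℓ) → Prog ℓ T)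
      (hx : Consistent x) (hy : Consistent y)
      (h : ∀ z, Shares (fmul d (recon x) (recon y)) z → Lockstep R fun i => next i (z i)) :
      Lockstep R fun i => .mult d (x i) (y i) (next i)

namespace Lockstep

variable {ℓ : ℕ} {T U : Type}

/-- Sequencing rule in the style of Hoare logic: it lets the protocols be verified line by line. -/
theorem bind {R : (Fin 3 → T) → Prop} {R' : (Fin 3 → U) → Prop} {p : Fin 3 → Prog ℓ T}
    {g : Fin 3 → T → Prog ℓ U} (hp : Lockstep R p)
    (hg : ∀ t, R t → Lockstep R' fun i => g i (t i)) :
    Lockstep R' fun i => (p i).bind (g i) := by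
  induction hp with
  | ret t h => exact hg t h
  | mult d x y next hx hy h ih => exact .mult d x y _ hx hy ih

theorem callMult (d : ℕ) {v w : Ring2 ℓ} {x y : Fin 3 → Held (2 ^ ℓ)} (hx : Shares v x)
    (hy : Shares w y) :
    Lockstep (Shares (fmul d v w)) fun i => Falcon.callMult d (x i) (y i) := by
  obtain ⟨hx, rfl⟩ := hx
  obtain ⟨hy, rfl⟩ := hy
  exact .mult d x y _ hx hy fun z hz => .ret z hz

theorem collect {n : ℕ} {R : Fin n → (Fin 3 → T) → Prop} {g : Fin 3 → Fin n → Prog ℓ T}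
    (h : ∀ j, Lockstep (R j) fun i => g i j) :
    Lockstep (fun t : Fin 3 → Fin n → T => ∀ j, R j fun i => t i j) fun i => Prog.collect n (g i) := by
  induction n with
  | zero => exact .ret (fun _ => Fin.elim0) fun j => j.elim0
  | succ n ih =>
    refine bind (h 0) fun t ht => bind (ih fun j => h j.succ) fun u hu => ?_
    refine .ret (fun i => (Fin.cons (t i) (u i) : Fin (n + 1) → T)) fun j => ?_
    refine Fin.cases ?_ (fun j => ?_) j
    · simpa using ht
    · simpa using hu j

theorem newtonProg (f : ℕ) {b : Ring2 ℓ} {tb : Fin 3 → Held (2 ^ ℓ)} (hb : Shares b tb) (n : ℕ)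
    {x : Ring2 ℓ} {tx : Fin 3 → Held (2 ^ ℓ)} (hx : Shares x tx) :
    Lockstep (Shares (newton f b n x)) fun i => Falcon.newtonProg f i (tb i) n (tx i) := by
  induction n generalizing x tx with
  | zero => exact .ret tx hx
  | succ n ih =>
    refine bind (callMult f hx hx) fun s hs => bind (callMult f hb hs) fun t ht => ?_
    exact bind (callMult (f + 1) hx ((Shares.pub _).sub ht)) fun y hy => ih hy

end Lockstep

/-! ### The simulator -/

/-- Simulation of calls of `F_Mult`, given the code that the corrupted party should run. -/
noncomputable def simulate {ℓ : ℕ} {ι κ T : Type} (G : T → Simulator ℓ ι κ) :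
    Prog ℓ T → Simulator ℓ ι κ
  | .ret a => G a
  | .mult d x y next =>
      .adversary (.multCall d) fun r =>
        open Classical in
        if r = .multIn x y then
          .sample (PMF.uniformOfFintype (Held (2 ^ ℓ))) fun z =>
            .adversary (.multOut z) fun r' =>
              if r' = .deliver then simulate G (next z) else .halt
        else .halt
  -- Never reached in the uses below: code in `Lockstep` contains only `ret` and `mult`.
  | _ => .halt

/-- Simulation of the last `n` calls of `F_Mult`, whose outputs `z` are prescribed. -/
noncomputable def simulateOutputs {ℓ : ℕ} {ι κ : Type} (d : ℕ) (last : Simulator ℓ ι κ) :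
    (n : ℕ) → (x y z : Fin n → Held (2 ^ ℓ)) → Simulator ℓ ι κ
  | 0, _, _, _ => last
  | n + 1, x, y, z =>
      .adversary (.multCall d) fun r =>
        open Classical in
        if r = .multIn (x 0) (y 0) then
          .adversary (.multOut (z 0)) fun r' =>
            if r' = .deliver then
              simulateOutputs d last n (fun j => x j.succ) (fun j => y j.succ) fun j => z j.succ
            else .halt
        else .halt

/-! ### Hybrid execution of multiplications against their simulation -/

section Execution

variable {ℓ : ℕ} {T ι κ : Type} [Fintype κ] [DecidableEq κ] (F : IdealF ℓ ι κ) (i : Fin 3)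
  (s : ι → Fin 3 → Ring2 ℓ) (A : Adversary ℓ)

open Classical in
-- By `Shares.consistent_gather_iff` all bad answers of the adversary end alike, so the case
-- distinctions collapse to the two tests that the simulator makes.
theorem exec_mult (d : ℕ) {x y : Fin 3 → Held (2 ^ ℓ)} (hx : Consistent x) (hy : Consistent y)
    (g g' : Held (2 ^ ℓ) → Prog ℓ T) (h : View ℓ) (c : List (Bits ℓ)) :
    exec i A (.mult d (x (i + 1)) (y (i + 1)) g) (.mult d (x (i + 2)) (y (i + 2)) g') h c =
      (A h (.multCall d)).bind fun r =>
        if r = .multIn (x i) (y i) then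
          (sharing (fmul d (recon x) (recon y))).bind fun z =>
            (A (h ++ [(.multCall d, r)]) (.multOut (held z i))).bind fun r' =>
              if r' = .deliver then
                exec i A (g (held z (i + 1))) (g' (held z (i + 2)))
                  (h ++ [(.multCall d, r)] ++ [(.multOut (held z i), r')]) c
              else PMF.pure
                (h ++ [(.multCall d, r)] ++ [(.multOut (held z i), r')], c, none)
        else PMF.pure (h ++ [(.multCall d, r)], c, none) := by
  rw [exec, if_pos rfl]
  congr 1
  funext r
  cases r with
  | multIn u v =>
    simp only [multF, Shares.consistent_gather_iff hx, Shares.consistent_gather_iff hy,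
      FromAdv.multIn.injEq]
    by_cases huv : u = x i ∧ v = y i
    · obtain ⟨rfl, rfl⟩ := huv
      simp only [and_self, if_true, Shares.gather_eq hx, Shares.gather_eq hy]
      congr 1
      funext z
      congr 1
      funext r'
      cases r' <;> simp
    · simp only [if_neg huv]
  | _ => simp

/-- A phase of calls of `F_Mult` is simulated perfectly, for any distribution `D` of the state of
the ideal functionality. -/
theorem exec_bind_eq_simulate {R : (Fin 3 → T) → Prop} {p : Fin 3 → Prog ℓ T}
    (hp : Lockstep R p) {Ω : Type} (D : PMF Ω) (st : Ω → IdealState ℓ κ) (c : List (Bits ℓ))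
    (hst : ∀ ω, (st ω).clear = c ∧ (st ω).honestOutput i = none)
    (g g' : T → Prog ℓ (κ → Held (2 ^ ℓ))) (G : T → Simulator ℓ ι κ)
    (hG : ∀ t, R t → ∀ h, exec i A (g (t (i + 1))) (g' (t (i + 2))) h c =
      D.bind fun ω => (G (t i)).run F i s A (st ω) h) (h : View ℓ) :
    exec i A ((p (i + 1)).bind g) ((p (i + 2)).bind g') h c =
      D.bind fun ω => (simulate G (p i)).run F i s A (st ω) h := by
  induction hp generalizing h with
  | ret t ht => exact hG t ht h
  | mult d x y next hx hy hn ih =>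
    simp only [Prog.bind]
    rw [exec_mult i A d hx hy]
    simp only [simulate, Simulator.run]
    -- The state drawn from `D` is independent of the adversary's answer, so its draw can be
    -- postponed.
    rw [PMF.bind_comm]
    congr 1
    funext r
    split_ifs with hr
    · simp only [Simulator.run]
      -- With the pair of party `i` as the random coins, `F_Mult` and the simulator draw the same
      -- uniform pair.
      rw [PMF.bind_comm, sharing_eq_map_gather i, PMF.bind_map]
      congr 1
      funext z
      simp only [Function.comp_apply, held_gather, Prod.mk.eta]
      rw [PMF.bind_comm]
      congr 1
      funext r'
      split_ifs with hr'
      · have hz : Shares (fmul d (recon x) (recon y))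
            (held (gather i z.1 z.2 (fmul d (recon x) (recon y) - z.1 - z.2))) := by
          refine ⟨fun _ => rfl, (sum_gather i z.1 z.2 _).trans ?_⟩
          abel
        have := ih _ hz (h ++ [(.multCall d, r)] ++ [(.multOut z, r')])
        simpa only [held_gather, Prod.mk.eta] using this
      -- After an abort the result depends on the state only through the two constants in `hst`, so
      -- the draw from `D` disappears.
      · simp only [Simulator.run, hst, PMF.bind_const]
    · simp only [Simulator.run, hst, PMF.bind_const]

/-- The last `n` calls of `F_Mult`, whose outputs are chosen by the ideal functionality. -/
theorem exec_collect_eq_simulateOutputs (d : ℕ) (c : List (Bits ℓ)) (last : Simulator ℓ ι κ)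
    (n : ℕ) {x y : Fin n → Fin 3 → Held (2 ^ ℓ)} (hx : ∀ j, Consistent (x j))
    (hy : ∀ j, Consistent (y j)) (st : (Fin n → Fin 3 → Ring2 ℓ) → IdealState ℓ κ)
    (hst : ∀ z, (st z).clear = c ∧ (st z).honestOutput i = none)
    (g g' : (Fin n → Held (2 ^ ℓ)) → Prog ℓ (κ → Held (2 ^ ℓ)))
    (hlast : ∀ z h, exec i A (g fun j => held (z j) (i + 1)) (g' fun j => held (z j) (i + 2)) h c =
      last.run F i s A (st z) h) (h : View ℓ) :
    exec i A
        ((Prog.collect n fun j => callMult d (x j (i + 1)) (y j (i + 1))).bind g)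
        ((Prog.collect n fun j => callMult d (x j (i + 2)) (y j (i + 2))).bind g') h c =
      (sharings fun j => fmul d (recon (x j)) (recon (y j))).bind fun z =>
        (simulateOutputs d last n (fun j => x j i) (fun j => y j i) fun j => held (z j) i).run
          F i s A (st z) h := by
  induction n generalizing h with
  | zero =>
    rw [sharings_zero, PMF.pure_bind, simulateOutputs, ← hlast]
    change exec i A (g Fin.elim0) (g' Fin.elim0) h c = _
    congr 2 <;> exact Subsingleton.elim _ _
  | succ n ih =>
    change exec i A (.mult d (x 0 (i + 1)) (y 0 (i + 1)) fun a =>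
      ((Prog.collect n fun j => callMult d (x j.succ (i + 1)) (y j.succ (i + 1))).bind
        fun b => .ret (Fin.cons a b)).bind g) (.mult d (x 0 (i + 2)) (y 0 (i + 2)) fun a =>
      ((Prog.collect n fun j => callMult d (x j.succ (i + 2)) (y j.succ (i + 2))).bind
        fun b => .ret (Fin.cons a b)).bind g') h c = _
    rw [exec_mult i A d (hx 0) (hy 0)]
    simp only [simulateOutputs, Simulator.run]
    rw [PMF.bind_comm]
    congr 1
    funext r
    split_ifs with hr
    · simp only [Simulator.run]
      rw [sharings_succ, PMF.bind_bind]
      congr 1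
      funext z
      simp only [PMF.bind_map, Function.comp_def, Fin.cons_zero]
      rw [PMF.bind_comm]
      congr 1
      funext r'
      split_ifs with hr'
      · simp only [Prog.bind_assoc, Prog.bind, Fin.cons_succ]
        -- The sharing `z` from the first call is now fixed, and the state depends only on the
        -- remaining ones.
        refine ih (fun j => hx j.succ) (fun j => hy j.succ) (fun z' => st (Fin.cons z z'))
          (fun z' => hst _) _ _ (fun z' h => ?_) _
        rw [← hlast]
        congr 2 <;> funext j <;> refine Fin.cases ?_ (fun j => ?_) j <;> rfl
      · simp only [Simulator.run, hst, PMF.bind_const]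
    · simp only [Simulator.run, hst, PMF.bind_const]

end Execution

/-! ### The leaked bits, the output layer and the call of `F_Pow` -/

/-- The bounding power, from all of its bits. -/
def decodeBits {ℓ : ℕ} (l : Bits ℓ) : ℕ := Nat.ofBits fun i => (l i).getD false

/-- Crude, but it ensures that `ℓ` bits determine the bounding power. -/
theorem boundPow_lt {ℓ : ℕ} (b : Ring2 ℓ) : boundPow b < 2 ^ ℓ :=
  (Nat.log_le_self 2 _).trans_lt (ZMod.val_lt b)

theorem decodeBits_topBits {ℓ : ℕ} (b : Ring2 ℓ) {k : Fin ℓ} (hk : (k : ℕ) = 0) :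
    decodeBits (topBits (boundPow b) k) = boundPow b := by
  have h : ∀ i : Fin ℓ, k ≤ i := fun i => Fin.le_def.2 (by omega)
  simp only [decodeBits, topBits, h, if_true, Option.getD_some]
  rw [Nat.ofBits_testBit, Nat.mod_eq_of_lt (boundPow_lt b)]

/-- The output layer of a protocol: `n` multiplications with truncation by `depth` bits, after
which `offset` is added. -/
structure OutputLayer (ℓ n : ℕ) where
  depth : ℕ
  left : Fin n → Held (2 ^ ℓ)
  right : Fin n → Held (2 ^ ℓ)
  offset : Fin n → Held (2 ^ ℓ)

/-- The three parties run the same output layer, for the values `v`. -/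
def OutputLayer.Computes {ℓ n : ℕ} (v : Fin n → Ring2 ℓ) (o : Fin 3 → OutputLayer ℓ n) : Prop :=
  ∃ (d : ℕ) (x y β : Fin n → Ring2 ℓ), (∀ i, (o i).depth = d) ∧
    (∀ j, Shares (x j) fun i => (o i).left j) ∧ (∀ j, Shares (y j) fun i => (o i).right j) ∧
    (∀ j, Shares (β j) fun i => (o i).offset j) ∧ ∀ j, v j = fmul d (x j) (y j) + β j

/-- The code for an output layer. -/
def OutputLayer.prog {ℓ n : ℕ} {κ : Type} (e : κ ≃ Fin n) (o : OutputLayer ℓ n) :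
    Prog ℓ (κ → Held (2 ^ ℓ)) :=
  (Prog.collect n fun j => callMult o.depth (o.left j) (o.right j)).bind fun z =>
    .ret fun k => z (e k) + o.offset (e k)

/-- Simulation of an output layer. -/
noncomputable def OutputLayer.simulator {ℓ n : ℕ} {ι κ : Type} (e : κ ≃ Fin n)
    (o : OutputLayer ℓ n) : Simulator ℓ ι κ :=
  .functionality .output fun
    -- The code adds the offset to each product, so the simulated product is the prescribed output
    -- minus the offset. Delivery is requested only after the adversary has let the last product
    -- through.
    | .shares z => simulateOutputs o.depth (.functionality .deliver fun _ => .halt) n o.left o.right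
        fun j => z (e.symm j) - o.offset j
    | _ => .halt

/-- Simulation of the call of `F_Pow` and of all that follows; `x` and `b` are what the corrupted
party holds of the inputs and of the argument of `F_Pow`. -/
noncomputable def simulatePow {ℓ n : ℕ} {ι κ : Type} (e : κ ≃ Fin n) (x : ι → Held (2 ^ ℓ))
    (b : Held (2 ^ ℓ)) (next : ℕ → Prog ℓ (OutputLayer ℓ n)) : Simulator ℓ ι κ :=
  .adversary .powCall fun
    | .powIn u k =>
        open Classical in
        if u = b then
          .functionality (.inputs x k) fun
            -- The reply is ignored, as in `exec`: only the index `k` decides whether `F_Pow`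
            -- aborts.
            | .leak l => .adversary (.powOut l) fun _ =>
                if (k : ℕ) = 0 then simulate (OutputLayer.simulator e) (next (decodeBits l))
                else .halt
            | _ => .halt
        else .halt
    | _ => .halt

section Execution

variable {ℓ n : ℕ} {ι κ : Type} [Fintype κ] [DecidableEq κ] (F : IdealF ℓ ι κ) (i : Fin 3)
  (s : ι → Fin 3 → Ring2 ℓ) (A : Adversary ℓ)

/-- Fresh sharings of the products, shifted by the fixed sharings of the offsets, have the law of
the functionality's output shares. This coupling covers all three parties at once, hence also the
honest outputs. -/
theorem exec_outputLayer (e : κ ≃ Fin n) {v : Fin n → Ring2 ℓ} {o : Fin 3 → OutputLayer ℓ n}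
    (ho : OutputLayer.Computes v o) (c : List (Bits ℓ)) (h : View ℓ) :
    exec i A ((o (i + 1)).prog e) ((o (i + 2)).prog e) h c =
      (sharings fun k => v (e k)).bind fun y =>
        ((o i).simulator e).run F i s A ⟨c, .computed y⟩ h := by
  obtain ⟨d, x, y, β, hd, hx, hy, hβ, hv⟩ := ho
  let off : Fin n → Fin 3 → Ring2 ℓ := fun j i => ((o i).offset j).1
  have hoff : ∀ j i, (o i).offset j = held (off j) i := fun j i =>
    congrFun (Shares.eq_held (hβ j).1) i
  have hst : (sharings fun k => v (e k)) =
      (sharings fun j => fmul d (recon fun i => (o i).left j) (recon fun i => (o i).right j)).map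
        fun z k => z (e k) + off (e k) := by
    refine sharings_eq_map_add e _ _ _ fun k => ?_
    rw [hv, (hx _).2, (hy _).2, ← (hβ (e k)).2]
    rfl
  rw [hst, PMF.bind_map, OutputLayer.prog, OutputLayer.prog, hd, hd]
  refine (exec_collect_eq_simulateOutputs F i s A d c (.functionality .deliver fun _ => .halt) n
    (x := fun j i => (o i).left j) (y := fun j i => (o i).right j)
    (fun j => (hx j).1) (fun j => (hy j).1)
    (fun z => ⟨c, .computed fun k => z (e k) + off (e k)⟩) (fun z => ⟨rfl, rfl⟩) _ _ ?_ h).trans ?_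
  · intro z h
    simp only [exec, Simulator.run, IdealF.step, PMF.pure_bind, IdealState.honestOutput, hoff]
    rfl
  · congr 1
    funext z
    simp only [Function.comp_apply, OutputLayer.simulator, Simulator.run, IdealF.step,
      PMF.pure_bind, hd, hoff, Equiv.apply_symm_apply]
    congr 2
    funext j
    simp [held]

theorem exec_pow (e : κ ≃ Fin n) {b : Fin 3 → Held (2 ^ ℓ)}
    (hb : Shares (F.scale fun j => ∑ i, s j i) b) {next : Fin 3 → ℕ → Prog ℓ (OutputLayer ℓ n)}
    (hnext : Lockstep (OutputLayer.Computes fun j => F.value (fun j => ∑ i, s j i) (e.symm j))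
      fun i => next i (boundPow (F.scale fun j => ∑ i, s j i))) (h : View ℓ) :
    exec i A (.pow (b (i + 1)) fun α => (next (i + 1) α).bind (OutputLayer.prog e))
        (.pow (b (i + 2)) fun α => (next (i + 2) α).bind (OutputLayer.prog e)) h [] =
      (simulatePow e (fun j => held (s j) i) (b i) (next i)).run F i s A ⟨[], .waiting⟩ h := by
  simp only [exec, simulatePow, Simulator.run]
  congr 1
  funext r
  cases r with
  | powIn u k =>
    simp only [powF, Shares.consistent_gather_iff hb.1]
    by_cases hu : u = b i
    · subst hu
      have hc : ∀ j, Consistent (held (s j)) := fun j _ => rfl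
      have hrec : (fun j => recon (held (s j))) = fun j => ∑ i, s j i := rfl
      simp only [if_true, Simulator.run, IdealF.step, gather_held, hc, implies_true, hrec,
        Shares.gather_eq hb.1, hb.2, List.nil_append]
      by_cases hk : (k : ℕ) = 0
      · simp only [hk, if_true, PMF.bind_map, Function.comp_def, Simulator.run]
        -- The output shares `y` are drawn before the adversary sees the leaked bits, but
        -- independently of its reply.
        rw [PMF.bind_comm]
        congr 1
        funext r'
        rw [decodeBits_topBits _ hk]
        -- Here `D` is the law of the output shares, which stay unused until the output layer.
        refine exec_bind_eq_simulate F i s A hnext _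
          (fun y => ⟨[topBits (boundPow (F.scale fun j => ∑ i, s j i)) k], .computed y⟩) _
          (fun y => ⟨rfl, rfl⟩) _ _ _ (fun o ho h => ?_) _
        rw [exec_outputLayer F i s A e ho]
        simp
      · simp only [hk, if_false, PMF.pure_bind, Simulator.run]
        rfl
    · simp only [if_neg hu, Simulator.run]
      rfl
  | _ => rfl

end Execution

/-! ### Security of the two protocols -/

/-- Security of a protocol that computes shares of the scale by multiplications, calls `F_Pow` on
them, and goes on with multiplications up to an output layer. -/
theorem securelyRealizes_of_lockstep {ℓ n : ℕ} {T ι κ : Type} [Fintype κ] [DecidableEq κ]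
    (P : Protocol ℓ ι κ) (F : IdealF ℓ ι κ) (e : κ ≃ Fin n)
    (pre : Fin 3 → (ι → Held (2 ^ ℓ)) → Prog ℓ T) (b : Fin 3 → T → Held (2 ^ ℓ))
    (post : Fin 3 → T → ℕ → Prog ℓ (OutputLayer ℓ n))
    (hP : ∀ i x, P i x = (pre i x).bind fun t => .pow (b i t) fun α =>
      (post i t α).bind (OutputLayer.prog e))
    (hpre : ∀ s : ι → Fin 3 → Ring2 ℓ, Lockstep
      (fun t => Shares (F.scale fun j => ∑ i, s j i) (fun i => b i (t i)) ∧
        Lockstep (OutputLayer.Computes fun j => F.value (fun j => ∑ i, s j i) (e.symm j))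
          fun i => post i (t i) (boundPow (F.scale fun j => ∑ i, s j i)))
      fun i => pre i fun j => held (s j) i) :
    SecurelyRealizes P F := by
  intro i
  refine ⟨fun x => simulate (fun t => simulatePow e x (b i t) (post i t)) (pre i x), ?_⟩
  intro s A
  rw [hybridExec, idealExec, hP, hP]
  -- Until `F_Pow` is called the functionality only waits, so the distribution of its state is
  -- trivial.
  refine (exec_bind_eq_simulate F i s A (hpre s) (PMF.pure ()) (fun _ => ⟨[], .waiting⟩) []
    (fun _ => ⟨rfl, rfl⟩) _ _ _ (fun t ht h => ?_) []).trans (PMF.pure_bind _ _)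
  rw [PMF.pure_bind]
  exact exec_pow F i s A e ht.1 (next := fun i => post i (t i)) ht.2 h

/-- Nothing precedes the call of `F_Pow`, and the output layer is the single final multiplication by
the scaled `a`, with offset `0`. -/
theorem divProtocol_securelyRealizes (ℓ f : ℕ) :
    SecurelyRealizes (divProtocol ℓ f) (divF ℓ f) := by
  refine securelyRealizes_of_lockstep (n := 1) _ _ (Equiv.ofUnique Unit (Fin 1))
    (fun _ x => .ret x) (fun _ x => x 1)
    (fun i x α => do
      let a := x 0
      let b := x 1
      let p := α + 1
      let one := pub i (encode ℓ p 1)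
      let w₀ := pub i (encode ℓ p 2.9142) - (2 : Ring2 ℓ) • b
      let t ← callMult p b w₀
      let ε₀ := one - t
      let ε₁ ← callMult p ε₀ ε₀
      let u ← callMult p w₀ (one + ε₀)
      let v ← callMult p u (one + ε₁)
      pure ⟨2 * p - f, fun _ => v, fun _ => (2 : Ring2 ℓ) ^ (f - 2 * p) • a, fun _ => 0⟩) ?_ ?_
  · intro i x
    simp only [divProtocol, bind, pure, callMult, callPow, Prog.bind, OutputLayer.prog,
      Prog.collect, add_zero]
    rfl
  · intro s
    have ha := Shares.held (s 0)
    have hb := Shares.held (s 1)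
    refine .ret (fun i j => held (s j) i) ⟨hb, ?_⟩
    have hw := (Shares.pub (encode ℓ (boundPow (∑ i, s 1 i) + 1) 2.9142)).sub (hb.smul 2)
    refine .bind (.callMult _ hb hw) fun t ht => ?_
    have hε := (Shares.pub (encode ℓ (boundPow (∑ i, s 1 i) + 1) 1)).sub ht
    refine .bind (.callMult _ hε hε) fun ε₁ hε₁ => ?_
    refine .bind (.callMult _ hw ((Shares.pub _).add hε)) fun u hu => ?_
    refine .bind (.callMult _ hu ((Shares.pub _).add hε₁)) fun v hv => ?_
    exact .ret _ ⟨_, _, _, fun _ => 0, fun _ => rfl, fun _ => hv, fun _ => ha.smul _,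
      fun _ => ⟨fun _ => rfl, by simp [recon]⟩, fun _ => (add_zero _).symm⟩

/-- The output layer consists of the `m` products with `a j - μ`, and its offset is `β`. The first
phase passes on its shares of `b` and `μ` along with the inputs, as the second phase needs them. -/
theorem bnProtocol_securelyRealizes (ℓ f m : ℕ) (ε : ℚ) :
    SecurelyRealizes (bnProtocol ℓ f m ε) (bnF ℓ f m ε) := by
  refine securelyRealizes_of_lockstep (n := m)
    (T := Held (2 ^ ℓ) × Held (2 ^ ℓ) × (Fin m ⊕ Fin 2 → Held (2 ^ ℓ))) _ _ (Equiv.refl _)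
    (fun i x => do
      let a := fun j : Fin m => x (.inl j)
      let c := pub i (encode ℓ f (1 / m))
      let μ ← callMult f c (∑ j, a j)
      let s ← Prog.collect m fun j => callMult f (a j - μ) (a j - μ)
      let v ← callMult f c (∑ j, s j)
      pure (v + pub i (encode ℓ f ε), μ, x))
    (fun _ t => t.1)
    (fun i t α => do
      let y ← newtonProg f i t.1 4 (pub i (bnInit ℓ f α))
      let g ← callMult f (t.2.2 (.inr 0)) y
      pure ⟨f, fun _ => g, fun j => t.2.2 (.inl j) - t.2.1, fun _ => t.2.2 (.inr 1)⟩) ?_ ?_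
  · intro i x
    simp only [bnProtocol, bind, pure, callMult, callPow, Prog.bind, OutputLayer.prog,
      Prog.bind_assoc]
    rfl
  · intro s
    have h := fun j => Shares.held (s j)
    refine .bind (.callMult _ (Shares.pub _) (Shares.sum fun j => h (.inl j))) fun μ hμ => ?_
    refine .bind (.collect fun j => .callMult _ ((h _).sub hμ) ((h _).sub hμ)) fun t ht => ?_
    refine .bind (.callMult _ (Shares.pub _) (Shares.sum ht)) fun v hv => ?_
    have hb := hv.add (Shares.pub (encode ℓ f ε))
    refine .ret _ ⟨hb, ?_⟩
    refine .bind (.newtonProg f hb 4 (Shares.pub _)) fun y hy => ?_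
    refine .bind (.callMult _ (h _) hy) fun g hg => ?_
    exact .ret _ ⟨_, _, _, _, fun _ => rfl, fun _ => hg, fun j => (h _).sub hμ, fun _ => h _,
      fun _ => rfl⟩

end Falcon

theorem theorem6 (ℓ f m : ℕ) (hℓ : 0 < ℓ) (hm : 0 < m) (ε : ℚ) :
    Falcon.SecurelyRealizes (Falcon.divProtocol ℓ f) (Falcon.divF ℓ f) ∧
      Falcon.SecurelyRealizes (Falcon.bnProtocol ℓ f m ε) (Falcon.bnF ℓ f m ε) := by
  exact ⟨Falcon.divProtocol_securelyRealizes ℓ f, Falcon.bnProtocol_securelyRealizes ℓ f m ε⟩
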